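/- For a multiset $L$ of integers $\geq 2$ and an integer $m\geq 0$, let $[L\mid m]$ denote the vertex-disjoint union of one $\ell$-cycle for each $\ell\in L$ (with multiplicity) and a path with $m$ edges, where a $2$-cycle is an edge counted twice; its size is $\epsilon=m+\sum_{\ell\in L}\ell$. A labeling of $[L\mid m]$ is a graph $\Gamma$ isomorphic to $[L\mid m]$ with vertices in $\mathbb{Z}$; $\Delta\Gamma$ is the multiset of all differences $x-y$ and $y-x$, over all edges $\{x,y\}$ of $\Gamma$ counted with multiplicity, and $\Delta_p\Gamma$ is the multiset of those produced by the edges of the path of $\Gamma$. If $[L\mid m]$ has size $\epsilon$ and at most one $2$-cycle, then a labeling $\Gamma$ of $[L\mid m]$ is graceful if its vertex set is $\{0,1,\ldots,\epsilon\}$ and $$\Delta\Gamma=\begin{cases}\pm\{1,2,\ldots,\epsilon\} & \text{if } [L\mid m] \text{ has no } 2\text{-cycle},\\ \pm\{1,3,3,4,5,\ldots,\epsilon\} & \text{if } [L\mid m] \text{ has exactly one } 2\text{-cycle},\end{cases}$$ as multisets. **Theorem.** Let $L_0$ be a finite (possibly empty) list of even integers greater than $2$, let $L_1$ be a finite (possibly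 empty) list of odd integers greater than $2$, and let $a\in\{0,1\}$. Put $$\epsilon_0=\max\bigl(1,\;2|L_0|(\max(L_0)+3)-1\bigr),\qquad \epsilon_1=\max\bigl(3,\;7^{|L_1|+a-1}(2\max(L_1)+1)\bigr),$$ where $|L|$ is the number of entries of $L$ counted with multiplicity and $\max(\emptyset)=0$. Then for every integer $\epsilon\geq 6\epsilon_0+7\epsilon_1+9$ the number $m=\epsilon-\sum_{\ell\in L_0}\ell-\sum_{\ell\in L_1}\ell-2a$ is a non-negative integer, and the graph $[L\mid m]$ of size $\epsilon$, where $L$ consists of the entries of $L_0$, the entries of $L_1$ and $a$ copies of $2$, has a graceful labeling $\Gamma$ such that $$\Delta_p\Gamma\supseteq\{d\in\mathbb{Z} : 4\epsilon_0+5\epsilon_1+7\leq d\leq\epsilon\}.$$ -/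

import Mathlib

/-- The edges `{u₀, u₁}, {u₁, u₂}, …, {u_{l-1}, u_l}` of the path `u₀, u₁, …, u_l`. -/
def pathEdges {V : Type*} (u : List V) : Multiset (Sym2 V) :=
  (List.zipWith (fun x y => s(x, y)) u u.tail : List (Sym2 V))

/-- The edges `{u₀, u₁}, …, {u_{l-1}, u_l}, {u_l, u₀}` of the cycle `(u₀, u₁, …, u_l)`. For a
2-cycle `(u₀, u₁)` this is the edge `{u₀, u₁}` counted twice. -/
def cycleEdges {V : Type*} (u : List V) : Multiset (Sym2 V) :=
  (List.zipWith (fun x y => s(x, y)) u (u.rotate 1) : List (Sym2 V))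

/-- A graph of type `[L ∣ m]` with vertices in `V`: the vertex-disjoint union of one `ℓ`-cycle for
each entry `ℓ` of the multiset `L` (whose entries are at least 2) and a path with `m` edges (an
isolated vertex if `m = 0`). It is given by the vertex sequences of its cycles and of its path;
every graph with vertices in `V` that is isomorphic to `[L ∣ m]` arises in this way, up to the
choice of a starting point and a direction on each component. -/
structure ZillionGraph (V : Type*) (L : Multiset ℕ) (m : ℕ) where
  /-- the vertex sequences of the cycles -/
  cycles : Multiset (List V)
  /-- the vertex sequence of the path -/
  path : List V
  map_length_cycles : cycles.map List.length = L
  length_path : path.length = m + 1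
  /-- no vertex is repeated, neither within a component nor across components -/
  nodup : (cycles.bind (fun C => (C : Multiset V)) + (path : Multiset V)).Nodup

namespace ZillionGraph

variable {V : Type*} {L : Multiset ℕ} {m : ℕ}

/-- The vertex set. -/
def verts [DecidableEq V] (Γ : ZillionGraph V L m) : Finset V :=
  (Γ.cycles.bind (fun C => (C : Multiset V)) + (Γ.path : Multiset V)).toFinset

/-- The multiset of edges. -/
def edges (Γ : ZillionGraph V L m) : Multiset (Sym2 V) :=
  Γ.cycles.bind cycleEdges + pathEdges Γ.path

end ZillionGraph

/-- The list of differences of a multiset of edges with ends in `ℤ`: every edge `{x, y}` contributes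
`x - y` and `y - x`, with multiplicity. -/
def edgeDiffs (E : Multiset (Sym2 ℤ)) : Multiset ℤ :=
  E.bind (Sym2.lift ⟨fun x y => ({x - y, y - x} : Multiset ℤ),
    fun _ _ => Multiset.pair_comm _ _⟩)

/-- The multiset `±X`, containing `d` and `-d` for each entry `d` of `X`. -/
def plusMinus (X : Multiset ℤ) : Multiset ℤ := X + X.map (fun d => -d)

namespace ZillionGraph

variable {L : Multiset ℕ} {m : ℕ}

/-- The list of differences `ΔΓ` of a labeling `Γ` of `[L ∣ m]`, that is, of a graph `Γ` of type
`[L ∣ m]` with vertices in `ℤ`. -/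
def diffs (Γ : ZillionGraph ℤ L m) : Multiset ℤ := edgeDiffs Γ.edges

/-- The list `Δ_p Γ` of the differences produced by the path of `Γ`. -/
def pathDiffs (Γ : ZillionGraph ℤ L m) : Multiset ℤ := edgeDiffs (pathEdges Γ.path)

/-- `Γ` is a graceful labeling of `[L ∣ m]`, a graph of size `ε = ∑ L + m` with at most one 2-cycle:
its vertex set is `{0, …, ε}`, and its list of differences is `±{1, …, ε}` if there is no 2-cycle,
and `±{1, 3, 3, 4, 5, …, ε}` if there is exactly one 2-cycle. -/
structure IsGraceful (Γ : ZillionGraph ℤ L m) : Prop where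
  count_two_le : L.count 2 ≤ 1
  verts_eq : Γ.verts = Finset.Icc (0 : ℤ) ((L.sum + m : ℕ) : ℤ)
  diffs_eq : Γ.diffs =
    if L.count 2 = 0 then plusMinus (Finset.Icc (1 : ℤ) ((L.sum + m : ℕ) : ℤ)).val
    else plusMinus ({1, 3, 3} + (Finset.Icc (4 : ℤ) ((L.sum + m : ℕ) : ℤ)).val)

end ZillionGraph

/-- `ε₀ = max (1, 2|L₀| (max L₀ + 3) - 1)`, where `max ∅ = 0`. If `L₀ = ∅` the value is 1, also with
truncated subtraction; see `eps0_cast`. -/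
def eps0 (L₀ : Multiset ℕ) : ℕ :=
  max 1 (2 * L₀.card * (L₀.sup + 3) - 1)

/-- `ε₁ = max (3, 7 ^ (|L₁| + a - 1) (2 max L₁ + 1))`, where `max ∅ = 0`. If `L₁ = ∅` and `a = 0` the
value is 3, whether the exponent is `-1` or truncated to 0; see `eps1_cast`. -/
def eps1 (L₁ : Multiset ℕ) (a : ℕ) : ℕ :=
  max 3 (7 ^ (L₁.card + a - 1) * (2 * L₁.sup + 1))

theorem eps0_cast (L₀ : Multiset ℕ) :
    (eps0 L₀ : ℤ) = max 1 (2 * (L₀.card : ℤ) * ((L₀.sup : ℤ) + 3) - 1) := by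
  unfold eps0
  have h : ((2 * L₀.card * (L₀.sup + 3) : ℕ) : ℤ) = 2 * (L₀.card : ℤ) * ((L₀.sup : ℤ) + 3) := by
    push_cast
    ring
  rw [← h]
  omega

theorem eps1_cast (L₁ : Multiset ℕ) (a : ℕ) :
    (eps1 L₁ a : ℚ) =
      max 3 ((7 : ℚ) ^ ((L₁.card : ℤ) + (a : ℤ) - 1) * (2 * (L₁.sup : ℚ) + 1)) := by
  unfold eps1
  rcases Nat.eq_zero_or_pos (L₁.card + a) with h | h
  · have h1 : L₁ = 0 := Multiset.card_eq_zero.mp (by omega)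
    have h2 : a = 0 := by omega
    subst h1 h2
    norm_num
  · have h1 : (L₁.card : ℤ) + (a : ℤ) - 1 = ((L₁.card + a - 1 : ℕ) : ℤ) := by omega
    rw [h1, zpow_natCast]
    push_cast
    rfl

/-! A bipartite configuration on {-p, …, q-1} with differences 1, …, p+q-1, all of whose edges join
a negative to a non-negative integer, can have its two sides moved apart: every difference rises by
the same amount. It can therefore be wrapped around anything that fills an interval of vertices and
realizes the small differences; a linking edge between path ends supplies the one difference in
between. For `AlphaEven L x t` the link has the right length as soon as the depths x agree. Paths
exist at nearly all depths (`alphaEven_path`, `alphaOdd_path`), and even cycles can be brought to a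
common depth (`alphaEven_cycles`).

Odd cycles are not bipartite. They are collected in a `Core`, a labeling of {0, …, n} of which only
the path end n-y matters later. Starting from a short path, a 2-cycle or one odd cycle,
`Core.add_odd` winds a further odd cycle around the core and closes it through one remote vertex,
which the path then avoids. Each such step multiplies a bound for 7n+6y by 7, whence ε₁.
`Core.merge` brings in all even cycles at once, and `Core.exists_final` wraps a path around the
result to reach the size ε; that path carries all large differences. -/

/-! ### Integer intervals as multisets -/

/-- The integer interval `{a, …, b}` as a multiset. -/
noncomputable def ivl (a b : ℤ) : Multiset ℤ := (Finset.Icc a b).val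

theorem count_ivl (z a b : ℤ) : (ivl a b).count z = if a ≤ z ∧ z ≤ b then 1 else 0 := by
  unfold ivl
  rw [Multiset.count_eq_of_nodup (Finset.nodup _)]
  simp [Finset.mem_Icc]

theorem mem_ivl {z a b : ℤ} : z ∈ ivl a b ↔ a ≤ z ∧ z ≤ b := by
  simp [ivl]

theorem count_map_of_leftInverse {f g : ℤ → ℤ} (hg : ∀ z, g (f z) = z) (hf : ∀ z, f (g z) = z)
    (V : Multiset ℤ) (z : ℤ) : (V.map f).count z = V.count (g z) := by
  have h : f.Injective := fun x y hxy => by rw [← hg x, ← hg y, hxy]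
  conv_lhs => rw [← hf z]
  exact Multiset.count_map_eq_count' _ _ h _

theorem map_ivl_add (a b c : ℤ) : (ivl a b).map (fun z => z + c) = ivl (a + c) (b + c) := by
  ext z
  rw [count_map_of_leftInverse (g := fun z => z - c) (by simp) (by simp), count_ivl, count_ivl]
  split_ifs <;> omega

theorem map_ivl_sub (a b c : ℤ) : (ivl a b).map (fun z => c - z) = ivl (c - b) (c - a) := by
  ext z
  rw [count_map_of_leftInverse (g := fun z => c - z) (by simp) (by simp), count_ivl, count_ivl]
  split_ifs <;> omega

theorem card_ivl {a b : ℤ} (h : a ≤ b + 1) : ((ivl a b).card : ℤ) = b + 1 - a := by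
  simp only [ivl, Finset.card_val, Int.card_Icc]
  omega

/-! ### Configurations with prescribed vertices and differences -/

/-- There is a path from `u` to `v` with vertex multiset `V` and multiset `D` of absolute
differences, all of whose edges satisfy `R`. -/
inductive IsPath (R : ℤ → ℤ → Prop) : ℤ → ℤ → Multiset ℤ → Multiset ℤ → Prop
  | single (u : ℤ) : IsPath R u u {u} 0
  | cons {u v w : ℤ} {V D : Multiset ℤ} : R u v → IsPath R v w V D →
      IsPath R u w (u ::ₘ V) (|u - v| ::ₘ D)

/-- There is a vertex-disjoint union of cycles whose lengths are the entries of `L`, and of a path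
from `u` to `v`, with vertex multiset `V` and multiset `D` of absolute differences, all of whose
edges satisfy `R`. (Disjointness amounts to `V` being duplicate-free.) -/
inductive IsConf (R : ℤ → ℤ → Prop) : Multiset ℕ → ℤ → ℤ → Multiset ℤ → Multiset ℤ → Prop
  | path {u v : ℤ} {V D : Multiset ℤ} : IsPath R u v V D → IsConf R 0 u v V D
  | cycle {L : Multiset ℕ} {u v x y : ℤ} {V D W F : Multiset ℤ} : IsConf R L u v V D →
      IsPath R x y W F → R y x → IsConf R (W.card ::ₘ L) u v (V + W) (D + F + {|y - x|})

section basic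

variable {R R' : ℤ → ℤ → Prop} {L L' : Multiset ℕ} {u v x y : ℤ} {V D W F : Multiset ℤ}

theorem IsPath.append (h : IsPath R u v V D) (h' : IsPath R x y W F) (hR : R v x) :
    IsPath R u y (V + W) (D + F + {|v - x|}) := by
  induction h with
  | single u =>
    convert IsPath.cons hR h' using 1
    · rw [Multiset.singleton_add]
    · rw [zero_add, add_comm, Multiset.singleton_add]
  | cons hr _ ih =>
    have := IsPath.cons hr (ih hR)
    simpa [Multiset.cons_add] using this

theorem IsPath.reverse (hs : ∀ a b, R a b → R b a) (h : IsPath R u v V D) :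
    IsPath R v u V D := by
  induction h with
  | single u => exact .single u
  | @cons u v w V D hr _ ih =>
    convert ih.append (.single u) (hs _ _ hr) using 1
    · rw [add_comm, Multiset.singleton_add]
    · rw [abs_sub_comm, add_zero, add_comm, Multiset.singleton_add]

theorem IsPath.map (f : ℤ → ℤ) (g : ℤ → ℤ)
    (hf : ∀ a b, R a b → R' (f a) (f b) ∧ |f a - f b| = g |a - b|) (h : IsPath R u v V D) :
    IsPath R' (f u) (f v) (V.map f) (D.map g) := by
  induction h with
  | single u => exact .single _
  | @cons u v w V D hr _ ih =>
    have := IsPath.cons (hf _ _ hr).1 ih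
    simpa [(hf _ _ hr).2] using this

theorem IsConf.toPath (h : IsConf R 0 u v V D) : IsPath R u v V D := by
  generalize hL : (0 : Multiset ℕ) = L at h
  cases h with
  | path h => exact h
  | cycle _ _ _ => simp at hL

theorem IsConf.map (f : ℤ → ℤ) (g : ℤ → ℤ)
    (hf : ∀ a b, R a b → R' (f a) (f b) ∧ |f a - f b| = g |a - b|) (h : IsConf R L u v V D) :
    IsConf R' L (f u) (f v) (V.map f) (D.map g) := by
  induction h with
  | path h => exact .path (h.map f g hf)
  | cycle _ hp hr ih =>
    have := IsConf.cycle ih (hp.map f g hf) (hf _ _ hr).1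
    simpa [(hf _ _ hr).2] using this

theorem IsConf.reverse (hs : ∀ a b, R a b → R b a) (h : IsConf R L u v V D) :
    IsConf R L v u V D := by
  induction h with
  | path h => exact .path (h.reverse hs)
  | cycle _ hp hr ih => exact .cycle ih hp hr

theorem IsConf.appendPath (h : IsConf R L u v V D) (h' : IsPath R x y W F) (hR : R v x) :
    IsConf R L u y (V + W) (D + F + {|v - x|}) := by
  induction h with
  | path h => exact .path (h.append h' hR)
  | cycle _ hp hr ih =>
    convert IsConf.cycle (ih hR) hp hr using 1
    · abel
    · abel

theorem IsConf.append (h : IsConf R L u v V D) (h' : IsConf R L' x y W F) (hR : R v x) :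
    IsConf R (L + L') u y (V + W) (D + F + {|v - x|}) := by
  induction h' with
  | path h' => simpa using h.appendPath h' hR
  | cycle _ hp hr ih =>
    convert IsConf.cycle (ih hR) hp hr using 1
    · simp
    · abel
    · abel

theorem IsConf.addCycle {ℓ : ℕ} (h : IsConf R L u v V D) (h' : IsPath R x y W F) (hR : R y x)
    (hl : W.card = ℓ) : IsConf R (ℓ ::ₘ L) u v (V + W) (D + F + {|y - x|}) :=
  hl ▸ IsConf.cycle h h' hR

theorem IsConf.congr {V' D' : Multiset ℤ} {u' v' : ℤ} (h : IsConf R L u v V D)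
    (hu : u = u') (hv : v = v') (hV : V = V') (hD : D = D') : IsConf R L u' v' V' D' := by
  subst hu hv hV hD; exact h

theorem IsPath.congr {V' D' : Multiset ℤ} {u' v' : ℤ} (h : IsPath R u v V D)
    (hu : u = u') (hv : v = v') (hV : V = V') (hD : D = D') : IsPath R u' v' V' D' := by
  subst hu hv hV hD; exact h

end basic

/-! ### Bipartite configurations and their nesting -/

/-- The relation that one of two integers is negative and the other is not. -/
def Cross (x y : ℤ) : Prop := x < 0 ∧ 0 ≤ y ∨ y < 0 ∧ 0 ≤ x

theorem Cross.symm {x y : ℤ} (h : Cross x y) : Cross y x := Or.symm h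

/-- The map that moves the negative integers down by `s` and the others up by `t`. -/
def spread (s t z : ℤ) : ℤ := if z < 0 then z - s else z + t

theorem spread_of_neg {s t z : ℤ} (h : z < 0) : spread s t z = z - s := if_pos h

theorem spread_of_nonneg {s t z : ℤ} (h : 0 ≤ z) : spread s t z = z + t := if_neg (not_lt.2 h)

/-- Every crossing edge bridges the gap opened at 0, so all of them lengthen equally. -/
theorem cross_spread {s t : ℤ} (hs : 0 ≤ s) (ht : 0 ≤ t) (a b : ℤ) (h : Cross a b) :
    Cross (spread s t a) (spread s t b) ∧
      |spread s t a - spread s t b| = |a - b| + (s + t) := by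
  rcases h with ⟨h1, h2⟩ | ⟨h1, h2⟩
  · rw [spread_of_neg h1, spread_of_nonneg h2]
    refine ⟨Or.inl ⟨by omega, by omega⟩, ?_⟩
    rw [abs_of_neg (by omega), abs_of_neg (by omega)]; ring
  · rw [spread_of_neg h1, spread_of_nonneg h2]
    refine ⟨Or.inr ⟨by omega, by omega⟩, ?_⟩
    rw [abs_of_pos (by omega), abs_of_pos (by omega)]; ring

theorem ivl_split {a b c : ℤ} (h1 : a ≤ b + 1) (h2 : b ≤ c) :
    ivl a c = ivl a b + ivl (b + 1) c := by
  ext z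
  simp only [Multiset.count_add, count_ivl]
  split_ifs <;> omega

theorem map_spread_ivl {s t p q : ℤ} (hp : 0 ≤ p) (hq : 0 ≤ q) :
    (ivl (-p) (q - 1)).map (spread s t) = ivl (-p - s) (-1 - s) + ivl t (q - 1 + t) := by
  rw [ivl_split (a := -p) (b := -1) (c := q - 1) (by omega) (by omega), Multiset.map_add]
  congr 1
  · have := map_ivl_add (-p) (-1) (-s)
    rw [← sub_eq_add_neg, ← sub_eq_add_neg] at this
    rw [← this]
    refine Multiset.map_congr rfl fun z hz => ?_
    rw [mem_ivl] at hz
    rw [spread_of_neg (by omega)]; ring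
  · have := map_ivl_add 0 (q - 1) t
    rw [zero_add] at this
    rw [show (-1 + 1 : ℤ) = 0 by norm_num, ← this]
    refine Multiset.map_congr rfl fun z hz => ?_
    rw [mem_ivl] at hz
    rw [spread_of_nonneg (by omega)]

/-- The indicator function of `{z | a ≤ z}`. -/
def stepAt (z a : ℤ) : ℤ := if a ≤ z then 1 else 0

/-- As differences of steps, counts of adjacent intervals telescope, so that `ring_nf` decides the
decompositions of intervals below. Empty intervals with a = b+1 are included. -/
theorem count_ivl_step {z a b : ℤ} (h : a ≤ b + 1) :
    ((ivl a b).count z : ℤ) = stepAt z a - stepAt z (b + 1) := by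
  rw [count_ivl]
  unfold stepAt
  split_ifs <;> simp <;> omega

theorem count_singleton_step {z a : ℤ} :
    (({a} : Multiset ℤ).count z : ℤ) = stepAt z a - stepAt z (a + 1) := by
  rw [Multiset.count_singleton]
  unfold stepAt
  split_ifs <;> simp <;> omega

theorem count_cons_step {z a : ℤ} {V : Multiset ℤ} :
    ((a ::ₘ V).count z : ℤ) = V.count z + (stepAt z a - stepAt z (a + 1)) := by
  rw [← Multiset.singleton_add, Multiset.count_add, Nat.cast_add, count_singleton_step, add_comm]

/-- A bipartite configuration with vertex set `{-p, …, q - 1}`, every edge of which joins a negative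
integer to a non-negative one, and with absolute differences `1, …, p + q - 1`. Its path goes from
`u` to `v`. -/
def Alpha (L : Multiset ℕ) (u v p q : ℤ) : Prop :=
  IsConf Cross L u v (ivl (-p) (q - 1)) (ivl 1 (p + q - 1))

theorem Alpha.place {L : Multiset ℕ} {u v p q : ℤ} (h : Alpha L u v p q) (s t : ℤ) (hp : 0 ≤ p)
    (hq : 0 ≤ q) (hs : 0 ≤ s) (ht : 0 ≤ t) :
    IsConf Cross L (spread s t u) (spread s t v) (ivl (-p - s) (-1 - s) + ivl t (q - 1 + t))
      (ivl (1 + (s + t)) (p + q - 1 + (s + t))) := by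
  rw [← map_spread_ivl hp hq, ← map_ivl_add]
  exact h.map _ _ (cross_spread hs ht)

theorem Alpha.swap {L : Multiset ℕ} {u v p q : ℤ} (h : Alpha L u v p q) :
    Alpha L (-1 - u) (-1 - v) q p := by
  have := h.map (R' := Cross) (fun z => -1 - z) id
    (fun a b hab => ⟨by unfold Cross at *; omega, by
      rw [show -1 - a - (-1 - b) = -(a - b) by ring, abs_neg, id]⟩)
  rw [Multiset.map_id, map_ivl_sub] at this
  refine this.congr rfl rfl ?_ ?_
  · congr 1 <;> ring
  · congr 1; ring

theorem Alpha.reverse {L : Multiset ℕ} {u v p q : ℤ} (h : Alpha L u v p q) : Alpha L v u p q :=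
  IsConf.reverse (fun _ _ => Cross.symm) h

/-- The second configuration goes around the first: its differences become p+q+1, p+q+2, …, and the
link must supply p+q. -/
theorem Alpha.append {L L' : Multiset ℕ} {u v x y p q p' q' : ℤ} (h : Alpha L u v p q)
    (h' : Alpha L' x y p' q') (hp : 0 ≤ p) (hq : 0 ≤ q) (hp' : 0 ≤ p') (hq' : 0 ≤ q')
    (hpq : 1 ≤ p + q) (hpq' : 1 ≤ p' + q')
    (hc : Cross v (spread p q x)) (hd : |v - spread p q x| = p + q) :
    Alpha (L + L') u (spread p q y) (p + p') (q + q') := by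
  refine (IsConf.append h (h'.place p q hp' hq' hp hq) hc).congr rfl rfl ?_ ?_
  · ext z
    simp only [Multiset.count_add, count_ivl]
    split_ifs <;> omega
  · rw [hd]
    ext z
    simp only [Multiset.count_add, count_ivl, Multiset.count_singleton]
    split_ifs <;> omega

/-- A bipartite configuration on `{-t, …, t - 1}` whose path goes from `-1 - x` to `t - 1 - x`. -/
def AlphaEven (L : Multiset ℕ) (x t : ℤ) : Prop := Alpha L (-1 - x) (t - 1 - x) t t

/-- A bipartite configuration on `{-t, …, t - 2}` whose path goes from `-1 - x` to `x - t`. -/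
def AlphaOdd (L : Multiset ℕ) (x t : ℤ) : Prop := Alpha L (-1 - x) (x - t) t (t - 1)

theorem Alpha.congr {L L' : Multiset ℕ} {u v p q u' v' p' q' : ℤ} (h : Alpha L u v p q)
    (hL : L = L') (hu : u = u') (hv : v = v') (hp : p = p') (hq : q = q') :
    Alpha L' u' v' p' q' := by
  subst hL hu hv hp hq; exact h

/-- The link runs from t-1-x to -1-x-t; equal depths make its length 2t. -/
theorem AlphaEven.add {L L' : Multiset ℕ} {x t t' : ℤ} (h : AlphaEven L x t)
    (h' : AlphaEven L' x t') (hx : 0 ≤ x) (ht : x < t) (ht' : x < t') :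
    AlphaEven (L + L') x (t + t') := by
  have e1 : spread t t (-1 - x) = -1 - x - t := spread_of_neg (by omega)
  have e2 : spread t t (t' - 1 - x) = t' - 1 - x + t := spread_of_nonneg (by omega)
  refine (Alpha.append h h' (by omega) (by omega) (by omega) (by omega) (by omega) (by omega)
    ?_ ?_).congr rfl rfl ?_ rfl rfl
  · rw [e1]; exact Or.inr ⟨by omega, by omega⟩
  · rw [e1, abs_of_pos (by omega)]; ring
  · rw [e2]; ring

/-- The inner path ends on the negative side, so the outer configuration is reflected first;
likewise in `AlphaOdd.add_odd`. -/
theorem AlphaOdd.add_even {L L' : Multiset ℕ} {x t t' : ℤ} (h : AlphaOdd L x t)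
    (h' : AlphaEven L' x t') (hx : 0 ≤ x) (ht : x < t) (ht' : x < t') :
    AlphaOdd (L + L') x (t + t') := by
  have e1 : spread t (t - 1) (-1 - (-1 - x)) = -1 - (-1 - x) + (t - 1) :=
    spread_of_nonneg (by omega)
  have e2 : spread t (t - 1) (-1 - (t' - 1 - x)) = -1 - (t' - 1 - x) - t :=
    spread_of_neg (by omega)
  refine (Alpha.append h (Alpha.swap h') (by omega) (by omega) (by omega) (by omega) (by omega)
    (by omega) ?_ ?_).congr rfl rfl ?_ rfl (by ring)
  · rw [e1]; exact Or.inl ⟨by omega, by omega⟩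
  · rw [e1, abs_of_neg (by omega)]; ring
  · rw [e2]; ring

theorem AlphaOdd.add_odd {L L' : Multiset ℕ} {x t t' : ℤ} (h : AlphaOdd L x t)
    (h' : AlphaOdd L' x t') (hx : 0 ≤ x) (ht : x < t) (ht' : x < t') :
    AlphaEven (L + L') x (t + t' - 1) := by
  have e1 : spread t (t - 1) (-1 - (-1 - x)) = -1 - (-1 - x) + (t - 1) :=
    spread_of_nonneg (by omega)
  have e2 : spread t (t - 1) (-1 - (x - t')) = -1 - (x - t') + (t - 1) :=
    spread_of_nonneg (by omega)
  refine (Alpha.append h (Alpha.swap h') (by omega) (by omega) (by omega) (by omega) (by omega)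
    (by omega) ?_ ?_).congr rfl rfl ?_ (by ring) (by ring)
  · rw [e1]; exact Or.inl ⟨by omega, by omega⟩
  · rw [e1, abs_of_neg (by omega)]; ring
  · rw [e2]; ring

theorem AlphaEven.congr {L L' : Multiset ℕ} {x t x' t' : ℤ} (h : AlphaEven L x t)
    (hL : L = L') (hx : x = x') (ht : t = t') : AlphaEven L' x' t' := by
  subst hL hx ht; exact h

theorem AlphaOdd.congr {L L' : Multiset ℕ} {x t x' t' : ℤ} (h : AlphaOdd L x t)
    (hL : L = L') (hx : x = x') (ht : t = t') : AlphaOdd L' x' t' := by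
  subst hL hx ht; exact h

theorem AlphaEven.mirror {L : Multiset ℕ} {x t : ℤ} (h : AlphaEven L x t) :
    AlphaEven L (t - 1 - x) t :=
  h.reverse.swap.congr rfl (by ring) (by ring) rfl rfl

theorem AlphaOdd.mirror {L : Multiset ℕ} {x t : ℤ} (h : AlphaOdd L x t) :
    AlphaOdd L (t - 1 - x) t :=
  h.reverse.congr rfl (by ring) (by ring) rfl rfl

/-! ### Paths with prescribed ends -/

theorem alpha_zigzag (x : ℕ) : AlphaEven 0 x (x + 1) ∧ AlphaOdd 0 x (x + 1) := by
  induction x with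
  | zero =>
    constructor
    · refine .path ((IsPath.cons (u := -1) (v := 0) (Or.inl ⟨by norm_num, le_rfl⟩)
        (.single 0)).congr (by norm_num) (by norm_num) ?_ ?_)
      · ext z
        simp only [Multiset.count_cons, count_ivl, Multiset.count_singleton]
        split_ifs <;> simp_all <;> omega
      · ext z
        simp only [Multiset.count_cons, count_ivl, Multiset.count_zero]
        norm_num
        split_ifs <;> omega
    · refine .path ((IsPath.single (-1)).congr (by norm_num) (by norm_num) ?_ ?_)
      · ext z
        simp only [count_ivl, Multiset.count_singleton]
        split_ifs <;> simp_all <;> omega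
      · ext z
        simp only [count_ivl, Multiset.count_zero]
        split_ifs <;> simp_all <;> omega
  | succ x ih =>
    obtain ⟨h1, h2⟩ := ih
    constructor
    · refine .path ((IsPath.cons (u := -2 - x) (v := x + 1) (Or.inl ⟨by omega, by omega⟩)
        (.cons (Or.inr ⟨by omega, by omega⟩) h1.toPath)).congr (by push_cast; ring)
          (by push_cast; ring) ?_ ?_)
      · ext z
        simp only [Multiset.count_cons, count_ivl]
        push_cast
        split_ifs <;> omega
      · ext z
        rw [abs_of_neg (by omega), abs_of_pos (by omega)]
        simp only [Multiset.count_cons, count_ivl]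
        push_cast
        split_ifs <;> omega
    · refine .path ((IsPath.cons (u := -2 - x) (v := x) (Or.inl ⟨by omega, by omega⟩)
        (.cons (Or.inr ⟨by omega, by omega⟩) h2.toPath)).congr (by push_cast; ring)
          (by push_cast; ring) ?_ ?_)
      · ext z
        simp only [Multiset.count_cons, count_ivl]
        push_cast
        split_ifs <;> omega
      · ext z
        rw [abs_of_neg (by omega), abs_of_pos (by omega)]
        simp only [Multiset.count_cons, count_ivl]
        push_cast
        split_ifs <;> omega

theorem alphaEven_zigzag {x : ℤ} (hx : 0 ≤ x) : AlphaEven 0 x (x + 1) := by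
  lift x to ℕ using hx
  exact (alpha_zigzag x).1

theorem alphaOdd_zigzag {x : ℤ} (hx : 0 ≤ x) : AlphaOdd 0 x (x + 1) := by
  lift x to ℕ using hx
  exact (alpha_zigzag x).2

theorem alphaEven_path {x t : ℤ} (hx : 0 ≤ x) (ht : x < t) : AlphaEven 0 x t := by
  lift t to ℕ using by omega
  induction t using Nat.strong_induction_on generalizing x with
  | _ t ih =>
    -- A zigzag of width y+1 in the centre leaves an outer path of width t-(y+1) > y at the same
    -- depth.
    have split : ∀ y : ℤ, 0 ≤ y → 2 * y + 2 ≤ t → AlphaEven 0 y t := by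
      intro y hy hyt
      have h := (alphaEven_zigzag hy).add
        (ih (t - (y + 1).toNat) (by omega) (x := y) hy (by omega)) hy (by omega) (by omega)
      exact h.congr (add_zero 0) rfl (by omega)
    rcases lt_trichotomy (2 * x + 1) (t : ℤ) with h | h | h
    -- Depths below the middle are split directly, the middle one consists of two odd zigzags, and
    -- larger ones come from the mirror image.
    · exact split x hx (by omega)
    · have := (alphaOdd_zigzag hx).add_odd (alphaOdd_zigzag hx) hx (by omega) (by omega)
      exact this.congr (add_zero 0) rfl (by omega)
    · rcases eq_or_lt_of_le (show x + 1 ≤ t by omega) with h' | h'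
      · rw [← h']; exact alphaEven_zigzag hx
      · have := (split (t - 1 - x) (by omega) (by omega)).mirror
        exact this.congr rfl (by ring) rfl

/-- For t = 2x+1 both ends -1-x and x-t would be the same vertex. -/
theorem alphaOdd_path {x t : ℤ} (hx : 0 ≤ x) (ht : x < t) (hne : t ≠ 2 * x + 1) :
    AlphaOdd 0 x t := by
  have split : ∀ y : ℤ, 0 ≤ y → 2 * y + 2 ≤ t → AlphaOdd 0 y t := by
    intro y hy hyt
    have h := (alphaOdd_zigzag hy).add_even
      (alphaEven_path (t := t - (y + 1)) hy (by omega)) hy (by omega) (by omega)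
    exact h.congr (add_zero 0) rfl (by ring)
  rcases lt_or_gt_of_ne hne with h | h
  · have := (split (t - 1 - x) (by omega) (by omega)).mirror
    exact this.congr rfl (by ring) rfl
  · exact split x hx (by omega)

theorem evenPiece {x t s r : ℤ} (hx : 0 ≤ x) (ht : x < t) (hs : 0 ≤ s) (hr : 0 ≤ r) :
    IsPath Cross (-1 - x - s) (t - 1 - x + r) (ivl (-t - s) (-1 - s) + ivl r (t - 1 + r))
      (ivl (1 + s + r) (2 * t - 1 + s + r)) := by
  refine (Alpha.place (alphaEven_path hx ht) s r (by omega) (by omega) hs hr).toPath.congr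
    (spread_of_neg (by omega)) (spread_of_nonneg (by omega)) rfl ?_
  congr 1 <;> ring

theorem evenPieceSwap {x t s r : ℤ} (hx : 0 ≤ x) (ht : x < t) (hs : 0 ≤ s) (hr : 0 ≤ r) :
    IsPath Cross (x + r) (x - t - s) (ivl (-t - s) (-1 - s) + ivl r (t - 1 + r))
      (ivl (1 + s + r) (2 * t - 1 + s + r)) := by
  refine (Alpha.place (Alpha.swap (alphaEven_path hx ht)) s r (by omega) (by omega) hs hr).toPath.congr
    ((spread_of_nonneg (by omega)).trans (by ring)) ((spread_of_neg (by omega)).trans (by ring))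
    rfl ?_
  congr 1 <;> ring

theorem AlphaOdd.piece {x t s r : ℤ} (h : AlphaOdd 0 x t) (hx : 0 ≤ x) (ht : x < t)
    (hs : 0 ≤ s) (hr : 0 ≤ r) :
    IsPath Cross (-1 - x - s) (x - t - s) (ivl (-t - s) (-1 - s) + ivl r (t - 2 + r))
      (ivl (1 + s + r) (2 * t - 2 + s + r)) := by
  refine (Alpha.place h s r (by omega) (by omega) hs hr).toPath.congr
    (spread_of_neg (by omega)) (spread_of_neg (by omega)) ?_ ?_
  · congr 2; ring
  · congr 1 <;> ring

theorem AlphaOdd.pieceSwap {x t s r : ℤ} (h : AlphaOdd 0 x t) (hx : 0 ≤ x) (ht : x < t)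
    (hs : 0 ≤ s) (hr : 0 ≤ r) :
    IsPath Cross (x + r) (t - 1 - x + r) (ivl (1 - t - s) (-1 - s) + ivl r (t - 1 + r))
      (ivl (1 + s + r) (2 * t - 2 + s + r)) := by
  refine (Alpha.place (Alpha.swap h) s r (by omega) (by omega) hs hr).toPath.congr
    ((spread_of_nonneg (by omega)).trans (by ring)) ((spread_of_nonneg (by omega)).trans (by ring))
    ?_ ?_
  · congr 2; ring
  · congr 1 <;> ring

/-- The zigzag from `0` outwards. -/
theorem alphaOdd_zero {t : ℤ} (ht : 0 < t) : AlphaOdd 0 0 t := by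
  by_cases h : t = 1
  · subst h; exact alphaOdd_zigzag le_rfl
  · exact alphaOdd_path le_rfl ht (by omega)

/-! ### Even cycles -/

/-- The classical labeling of the 4q-cycle misses a single vertex, which serves as the path; this is
the case t = 2x+1 excluded for paths alone. -/
theorem alphaOdd_cycle_four_mul {q : ℤ} (hq : 1 ≤ q) :
    AlphaOdd {(4 * q).toNat} q (2 * q + 1) := by
  have h1 := (alphaOdd_zero (t := q + 1) (by omega)).piece (s := 0) (r := 0) le_rfl (by omega)
    le_rfl le_rfl
  have h2 := (alphaOdd_zero (t := q) (by omega)).pieceSwap (s := q + 1) (r := q + 1) le_rfl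
    (by omega) (by omega) (by omega)
  have hc := IsConf.addCycle (ℓ := (4 * q).toNat) (.path (.single q))
    (h1.append h2 (Or.inl ⟨by omega, by omega⟩)) (Or.inr ⟨by omega, by omega⟩) (by
      zify
      simp only [Multiset.card_add, Nat.cast_add]
      rw [card_ivl (by omega), card_ivl (by omega), card_ivl (by omega), card_ivl (by omega)]
      omega)
  have : Alpha {(4 * q).toNat} q q (2 * q) (2 * q + 1) := by
    refine IsConf.congr hc rfl rfl ?_ ?_
    · ext z
      simp only [Multiset.count_add, count_ivl, Multiset.count_singleton]
      split_ifs <;> omega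
    · rw [abs_of_neg (by omega), abs_of_pos (by omega)]
      ext z
      simp only [Multiset.count_add, count_ivl, Multiset.count_singleton, Multiset.count_zero]
      split_ifs <;> omega
  exact this.swap.congr rfl rfl (by ring) rfl (by ring)

/-- The cycle uses the differences 1, …, 4q+1 and 4q+3 and skips the vertices -q-2 and 2q. These
become the ends of a path that is otherwise outside, with links 4q+2 and 4q+4. -/
theorem alphaEven_cycle_four_mul_add_two {q : ℤ} (hq : 2 ≤ q) :
    AlphaEven {(4 * q + 2).toNat} (q + 1) (3 * q + 2) := by
  have h1 := evenPiece (x := 0) (t := q + 1) (s := 0) (r := 0) le_rfl (by omega) le_rfl le_rfl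
  have h2 := evenPiece (x := 0) (t := q - 1) (s := q + 2) (r := q + 1) le_rfl (by omega)
    (by omega) (by omega)
  have h3 : IsPath Cross (-2 * q - 2) (2 * q + 1) _ _ :=
    .cons (Or.inl ⟨by omega, by omega⟩) (.single (2 * q + 1))
  have h4 := (evenPiece (x := 1) (t := q) (s := 2 * q + 2) (r := 2 * q + 2) (by omega) (by omega)
    (by omega) (by omega)).reverse (fun _ _ => Cross.symm)
  have h5 : IsPath Cross (-q - 2) (2 * q) _ _ :=
    .cons (Or.inl ⟨by omega, by omega⟩) (h4.append (.single (2 * q)) (Or.inl ⟨by omega, by omega⟩))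
  have hc := IsConf.addCycle (ℓ := (4 * q + 2).toNat) (.path h5)
    ((h1.append h2 (Or.inr ⟨by omega, by omega⟩)).append h3 (Or.inr ⟨by omega, by omega⟩))
    (Or.inr ⟨by omega, by omega⟩) (by
      zify
      simp only [Multiset.card_add, Nat.cast_add, Multiset.card_cons, Multiset.card_singleton]
      rw [card_ivl (by omega), card_ivl (by omega), card_ivl (by omega), card_ivl (by omega)]
      push_cast
      omega)
  refine IsConf.congr hc (by ring) (by ring) ?_ ?_
  · ext z
    zify
    simp (disch := omega) only [Multiset.count_add, Nat.cast_add, count_ivl_step,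
      count_singleton_step, count_cons_step]
    ring_nf
  · rw [abs_of_pos (a := 2 * q + 1 - _) (by omega), abs_of_neg (a := -2 * q - 2 - _) (by omega),
      abs_of_pos (a := q + 1 - 1 - 0 + 0 - _) (by omega), abs_of_neg (a := -q - 2 - _) (by omega),
      abs_of_pos (a := q - 1 - 1 - 0 + _ - _) (by omega), abs_of_neg (a := -1 - 1 - _ - _) (by omega)]
    ext z
    zify
    simp (disch := omega) only [Multiset.count_add, Nat.cast_add, count_ivl_step,
      count_singleton_step, count_cons_step, Multiset.count_zero, Nat.cast_zero]
    ring_nf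

theorem alphaEven_cycle_six : AlphaEven {6} 1 4 := by
  have h1 : IsPath Cross (-2) 2 _ _ := .cons (Or.inl ⟨by decide, by decide⟩) (.single 2)
  have h2 : IsPath Cross (-1) 1 {-1, 0, -3, 3, -4, 1} _ :=
    .cons (Or.inl ⟨by decide, by decide⟩) <| .cons (Or.inr ⟨by decide, by decide⟩) <|
    .cons (Or.inl ⟨by decide, by decide⟩) <| .cons (Or.inr ⟨by decide, by decide⟩) <|
    .cons (Or.inl ⟨by decide, by decide⟩) <| .single 1
  refine IsConf.congr ((IsConf.path h1).addCycle (ℓ := 6) h2 (Or.inr ⟨by decide, by decide⟩) rfl)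
    (by norm_num) (by norm_num) (by decide) (by decide)

/-- Wrapping a path of suitable width around the cycle and then mirroring turns the cycle's own
depth into the prescribed X-1, so that different cycles can be nested. -/
theorem alphaEven_cycle {ℓ : ℕ} (hℓ : Even ℓ) (h2 : 2 < ℓ) {X : ℤ} (hX : 3 * (ℓ : ℤ) + 6 ≤ 4 * X) :
    ∃ t : ℤ, X ≤ t ∧ 4 * t ≤ 4 * X + ℓ + 2 ∧ AlphaEven {ℓ} (X - 1) t := by
  obtain ⟨m, hm⟩ := hℓ
  obtain ⟨q, hq | hq⟩ : ∃ q : ℕ, ℓ = 4 * q ∨ ℓ = 4 * q + 2 := ⟨m / 2, by omega⟩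
  · have h := (alphaOdd_cycle_four_mul (q := q) (by omega)).add_odd
      (alphaOdd_path (x := q) (t := X - q) (by omega) (by omega) (by omega)) (by omega) (by omega)
      (by omega)
    refine ⟨X + q, by omega, by omega, h.mirror.congr ?_ (by ring) (by ring)⟩
    rw [add_zero, hq]; rfl
  · obtain rfl | hq1 : q = 1 ∨ 2 ≤ q := by omega
    · have h := alphaEven_cycle_six.add (alphaEven_path (x := 1) (t := X + 1 - 4) (by omega)
        (by omega)) (by omega) (by omega) (by omega)
      refine ⟨X + 1, by omega, by omega, h.mirror.congr ?_ (by ring) (by ring)⟩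
      rw [add_zero, hq]
    · have h := (alphaEven_cycle_four_mul_add_two (q := q) (by omega)).add
        (alphaEven_path (x := q + 1) (t := X + (q + 1) - (3 * q + 2)) (by omega)
        (by omega)) (by omega) (by omega) (by omega)
      refine ⟨X + (q + 1), by omega, by omega, h.mirror.congr ?_ (by ring) (by ring)⟩
      rw [add_zero, hq]; rfl

theorem alphaEven_cycles {M : ℕ} {X B : ℤ} (hX : 3 * (M : ℤ) + 6 ≤ 4 * X)
    (hB : 4 * X + M + 2 < 4 * B + 4) (L : Multiset ℕ) (hL : ∀ ℓ ∈ L, Even ℓ ∧ 2 < ℓ ∧ ℓ ≤ M)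
    (h0 : L ≠ 0) :
    ∃ p : ℤ, X ≤ p ∧ p ≤ L.card * B ∧ AlphaEven L (X - 1) p := by
  induction L using Multiset.induction_on with
  | empty => exact absurd rfl h0
  | cons ℓ L ih =>
    obtain ⟨he, h2, hM⟩ := hL ℓ (Multiset.mem_cons_self _ _)
    obtain ⟨t, ht, ht', h⟩ := alphaEven_cycle he h2 (X := X) (by omega)
    have htB : t ≤ B := by omega
    by_cases hL0 : L = 0
    · subst hL0
      exact ⟨t, ht, by simpa using htB, h⟩
    · obtain ⟨p, hp, hp', h'⟩ := ih (fun ℓ' hℓ' => hL ℓ' (Multiset.mem_cons_of_mem hℓ')) hL0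
      refine ⟨t + p, by omega, ?_, h.add h' (by omega) (by omega) (by omega)⟩
      rw [Multiset.card_cons]
      push_cast
      linarith

/-! ### Cores and operations on them -/

/-- The relation satisfied by all pairs of integers. -/
def Anything (_ _ : ℤ) : Prop := True

theorem IsPath.anything {R : ℤ → ℤ → Prop} {u v : ℤ} {V D : Multiset ℤ} (h : IsPath R u v V D) :
    IsPath Anything u v V D := by
  simpa using h.map (R' := Anything) id id fun _ _ _ => ⟨trivial, rfl⟩

theorem IsConf.anything {R : ℤ → ℤ → Prop} {L : Multiset ℕ} {u v : ℤ} {V D : Multiset ℤ}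
    (h : IsConf R L u v V D) : IsConf Anything L u v V D := by
  simpa using h.map (R' := Anything) id id fun _ _ _ => ⟨trivial, rfl⟩

/-- A labeling with vertex set `{0, …, n}` and absolute differences `W ∪ {4, …, n}`, in which the
path has `n - y` as an end vertex. -/
def Core (W : Multiset ℤ) (L : Multiset ℕ) (n y : ℤ) : Prop :=
  3 ≤ n ∧ 0 ≤ y ∧ ∃ u, IsConf Anything L u (n - y) (ivl 0 n) (W + ivl 4 n)

theorem Core.of_top {W : Multiset ℤ} {L L' : Multiset ℕ} {u v p q n y : ℤ} {D : Multiset ℤ}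
    (h : IsConf Anything L u v (ivl (-p) q) D) (hL : L = L') (hn : n = p + q) (hy : y = q - v)
    (hn3 : 3 ≤ n) (hy0 : 0 ≤ y) (hD : D = W + ivl 4 n) : Core W L' n y := by
  refine ⟨hn3, hy0, u + p, ?_⟩
  have := h.map (R' := Anything) (fun z => z + p) id
    (fun a b _ => ⟨trivial, by rw [add_sub_add_right_eq_sub, id]⟩)
  rw [Multiset.map_id, map_ivl_add] at this
  subst hL
  refine this.congr rfl (by rw [hn, hy]; ring) ?_ hD
  rw [hn]
  congr 1 <;> ring

theorem Core.of_bottom {W : Multiset ℤ} {L L' : Multiset ℕ} {u v p q n y : ℤ} {D : Multiset ℤ}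
    (h : IsConf Anything L u v (ivl (-p) q) D) (hL : L = L') (hn : n = p + q) (hy : y = p + v)
    (hn3 : 3 ≤ n) (hy0 : 0 ≤ y) (hD : D = W + ivl 4 n) : Core W L' n y := by
  refine ⟨hn3, hy0, q - u, ?_⟩
  have := h.map (R' := Anything) (fun z => q - z) id
    (fun a b _ => ⟨trivial, by rw [sub_sub_sub_cancel_left, abs_sub_comm, id]⟩)
  rw [Multiset.map_id, map_ivl_sub] at this
  subst hL
  refine this.congr rfl (by rw [hn, hy]; ring) ?_ hD
  rw [hn]
  congr 1 <;> ring

/-- A path piece starting at depth y is linked by the difference n+1 and ends again at distance y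
from the top. -/
theorem Core.extend {W : Multiset ℤ} {L : Multiset ℕ} {n y t : ℤ} (h : Core W L n y)
    (ht : y < t) : Core W L (n + 2 * t) y := by
  obtain ⟨hn, hy, u, h⟩ := h
  have hc := h.appendPath (evenPiece (s := 0) (r := n + 1) hy ht le_rfl (by omega)).anything trivial
  refine Core.of_top (p := t) (q := n + t) (hc.congr rfl rfl ?_ rfl) rfl (by ring) (by ring)
    (by omega) hy ?_
  · ext z
    zify
    simp (disch := omega) only [Multiset.count_add, Nat.cast_add, count_ivl_step]
    ring_nf
  · simp (disch := omega) only [abs_of_pos]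
    ext z
    zify
    simp (disch := omega) only [Multiset.count_add, Nat.cast_add, count_ivl_step,
      count_singleton_step]
    ring_nf

/-- The bipartite configuration lies directly around the core, but the path first visits an outer
piece, linked by n+2p+1, and returns inwards by n+1. Hence the depths y and x need not agree. -/
theorem Core.merge {W : Multiset ℤ} {L L' : Multiset ℕ} {n y x p : ℤ} (h : Core W L n y)
    (h' : AlphaEven L' x p) (hx : 0 ≤ x) (hp : x < p) (hxn : x ≤ n) :
    Core W (L + L') (3 * n + 4 * p + 2 * y + 2 - 2 * x) (2 * p + n + y - 2 * x) := by
  obtain ⟨hn, hy, u, h⟩ := h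
  have h1 := (evenPiece (x := p + y) (t := n - x + 1 + p + y) (s := p) (r := n + 1 + p)
    (by omega) (by omega) (by omega) (by omega)).anything
  have h2 := ((Alpha.place h' 0 (n + 1) (by omega) (by omega) le_rfl (by omega)).anything.reverse
    (fun _ _ h => h)).congr (spread_of_nonneg (by omega)) (spread_of_neg (by omega)) rfl rfl
  refine Core.of_bottom (p := p + (n - x + 1 + p + y)) (q := n + p + (n - x + 1 + p + y))
    (((h.appendPath h1 trivial).append h2 trivial).congr rfl rfl ?_ rfl)
    rfl (by ring) (by ring) (by omega) (by omega) ?_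
  · ext z
    zify
    simp (disch := omega) only [Multiset.count_add, Nat.cast_add, count_ivl_step]
    ring_nf
  · simp (disch := omega) only [abs_of_pos]
    ext z
    zify
    simp (disch := omega) only [Multiset.count_add, Nat.cast_add, count_ivl_step,
      count_singleton_step]
    ring_nf

/-- The cycle zigzags around the core from -1 to n+k and closes through the vertex -n-2, using the
differences n+1, …, n+2k and 2n+k+2. The blocks `p1` and `p3` leave out the last difference between
them and stop just before -n-2; `p2` lies beyond that vertex. -/
theorem Core.add_odd_of_even {W : Multiset ℤ} {L : Multiset ℕ} {n y k g : ℤ} (h : Core W L n y)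
    (hk : 1 ≤ k) (hg : n + 1 - k = 2 * g) (hyg : y + k < g) :
    Core W ((2 * k + 1).toNat ::ₘ L) (4 * n + 2 * y + k + 3) (n + 1 + y) := by
  obtain ⟨hn, hy, u, h⟩ := h
  obtain rfl : n = 2 * g + k - 1 := by omega
  generalize hm : 2 * g + k - 1 = n at *
  have c1 := (evenPiece (x := 0) (t := k) (s := 0) (r := n + 1) le_rfl (by omega)
    le_rfl (by omega)).anything
  have p1 := (evenPiece (x := y + k) (t := g) (s := k) (r := n + 1 + k) (by omega) hyg
    (by omega) (by omega)).anything
  have p2 := ((alphaOdd_zigzag (x := g + (y + k) - 1) (by omega)).piece (s := k + 2 * g + 1)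
    (r := n + 1 + k + 2 * g) (by omega) (by omega) (by omega) (by omega)).anything
  have p3 := ((evenPiece (x := 0) (t := g) (s := k + g) (r := n + 1 + k + g) le_rfl (by omega)
    (by omega) (by omega)).reverse (fun _ _ => Cross.symm)).anything
  have hc := (((h.appendPath p1 trivial).appendPath p2 trivial).appendPath p3 trivial).addCycle
    (ℓ := (2 * k + 1).toNat) (c1.append (.single (-n - 2)) trivial) trivial (by
      zify
      simp only [Multiset.card_add, Nat.cast_add, Multiset.card_singleton]
      rw [card_ivl (by omega), card_ivl (by omega)]
      push_cast
      omega)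
  refine Core.of_bottom (p := k + 3 * g + (y + k) + 1) (q := n + k + 3 * g + (y + k) - 1)
    (hc.congr rfl rfl ?_ rfl) rfl (by omega) (by omega) (by omega) (by omega) ?_
  · ext z
    zify
    simp (disch := omega) only [Multiset.count_add, Nat.cast_add, count_ivl_step,
      count_singleton_step]
    subst hm
    ring_nf
  · simp (disch := omega) only [abs_of_pos, abs_of_neg]
    ext z
    zify
    simp (disch := omega) only [Multiset.count_add, Nat.cast_add, count_ivl_step,
      count_singleton_step, Multiset.count_zero, Nat.cast_zero]
    subst hm
    ring_nf

/-- The other parity shifts -n-2 by one place, so `p1` gets an extra negative vertex. It is then an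
odd path, and `hne` keeps its two ends distinct. -/
theorem Core.add_odd_of_odd {W : Multiset ℤ} {L : Multiset ℕ} {n y k g : ℤ} (h : Core W L n y)
    (hk : 1 ≤ k) (hg : n + 1 - k = 2 * g + 1) (hyg : y + k ≤ g) (hne : g ≠ 2 * (y + k)) :
    Core W ((2 * k + 1).toNat ::ₘ L) (4 * n + 2 * y + k + 4) (n + 1 + y) := by
  obtain ⟨hn, hy, u, h⟩ := h
  obtain rfl : n = 2 * g + k := by omega
  generalize hm : 2 * g + k = n at *
  have c1 := (evenPiece (x := 0) (t := k) (s := 0) (r := n + 1) le_rfl (by omega)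
    le_rfl (by omega)).anything
  have p1 := ((alphaOdd_path (x := y + k) (t := g + 1) (by omega) (by omega) (by omega)).piece
    (s := k) (r := n + 1 + k) (by omega) (by omega) (by omega) (by omega)).anything
  have p2 := (evenPieceSwap (x := g + (y + k)) (t := g + (y + k) + 1) (s := k + 2 * g + 2)
    (r := n + 1 + k + 2 * g) (by omega) (by omega) (by omega) (by omega)).anything
  have p3 := ((evenPiece (x := 0) (t := g) (s := k + g + 1) (r := n + 1 + k + g) le_rfl (by omega)
    (by omega) (by omega)).reverse (fun _ _ => Cross.symm)).anything
  have hc := (((h.appendPath p1 trivial).appendPath p2 trivial).appendPath p3 trivial).addCycle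
    (ℓ := (2 * k + 1).toNat) (c1.append (.single (-n - 2)) trivial) trivial (by
      zify
      simp only [Multiset.card_add, Nat.cast_add, Multiset.card_singleton]
      rw [card_ivl (by omega), card_ivl (by omega)]
      push_cast
      omega)
  refine Core.of_bottom (p := k + 3 * g + (y + k) + 3) (q := n + k + 3 * g + (y + k) + 1)
    (hc.congr rfl rfl ?_ rfl) rfl (by omega) (by omega) (by omega) (by omega) ?_
  · ext z
    zify
    simp (disch := omega) only [Multiset.count_add, Nat.cast_add, count_ivl_step,
      count_singleton_step]
    subst hm
    ring_nf
  · simp (disch := omega) only [abs_of_pos, abs_of_neg]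
    ext z
    zify
    simp (disch := omega) only [Multiset.count_add, Nat.cast_add, count_ivl_step,
      count_singleton_step, Multiset.count_zero, Nat.cast_zero]
    subst hm
    ring_nf

theorem Core.add_odd {W : Multiset ℤ} {L : Multiset ℕ} {n y k : ℤ} (h : Core W L n y)
    (hk : 1 ≤ k) (hn : 2 * y + 3 * k + 1 ≤ n) (hne : n ≠ 4 * y + 5 * k) :
    ∃ n', n' ≤ 4 * n + 2 * y + k + 4 ∧ 4 * n + 2 * y + k + 3 ≤ n' ∧
      Core W ((2 * k + 1).toNat ::ₘ L) n' (n + 1 + y) := by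
  obtain ⟨g, hg | hg⟩ := Int.even_or_odd' (n + 1 - k)
  · exact ⟨_, by omega, le_rfl, h.add_odd_of_even hk hg (by omega)⟩
  · exact ⟨_, le_rfl, by omega, h.add_odd_of_odd hk hg (by omega) (by omega)⟩

/-! ### Initial cores -/

theorem core_path : Core {1, 2, 3} 0 3 0 := by
  have h : IsPath Anything 1 3 {1, 2, 0, 3} _ :=
    .cons trivial <| .cons trivial <| .cons trivial <| .single 3
  exact ⟨le_rfl, le_rfl, 1, (IsConf.path h).congr rfl (by norm_num) (by decide) (by decide)⟩

theorem core_two : Core {1, 3, 3} {2} 3 1 := by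
  have h : IsPath Anything 1 2 {1, 2} _ := .cons trivial (.single 2)
  have h' : IsPath Anything 0 3 {0, 3} _ := .cons trivial (.single 3)
  exact ⟨le_rfl, by norm_num, 1, ((IsConf.path h).addCycle (ℓ := 2) h' trivial rfl).congr rfl
    (by norm_num) (by decide) (by decide)⟩

theorem core_five : Core {1, 2, 3} {5} 6 2 := by
  have h : IsPath Anything 3 4 {3, 4} _ := .cons trivial (.single 4)
  have h' : IsPath Anything 0 2 {0, 6, 1, 5, 2} _ :=
    .cons trivial <| .cons trivial <| .cons trivial <| .cons trivial <| .single 2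
  exact ⟨by norm_num, by norm_num, 3, ((IsConf.path h).addCycle (ℓ := 5) h' trivial rfl).congr rfl
    (by norm_num) (by decide) (by decide)⟩

theorem one_two_three_add_ivl {n : ℤ} (hn : 3 ≤ n) : ({1, 2, 3} : Multiset ℤ) + ivl 4 n = ivl 1 n := by
  rw [ivl_split (a := 1) (b := 3) (c := n) (by omega) hn]
  rfl

/-- The closing edge, of difference 2r+1, joins two negative vertices and makes the cycle odd. The
path is the skipped vertex r. -/
theorem core_four_mul_add_three {r : ℤ} (hr : 0 ≤ r) :
    Core {1, 2, 3} {(4 * r + 3).toNat} (4 * r + 3) (r + 1) := by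
  have c1 := ((alphaOdd_zero (t := r + 1) (by omega)).piece (s := 0) (r := 0) le_rfl (by omega)
    le_rfl le_rfl).anything
  have c2 := (evenPieceSwap (x := 0) (t := r + 1) (s := r + 1) (r := r + 1) le_rfl
    (by omega) (by omega) (by omega)).anything
  have hc := IsConf.addCycle (ℓ := (4 * r + 3).toNat) (.path (.single r))
    (c1.append c2 trivial) trivial (by
      zify
      simp only [Multiset.card_add, Nat.cast_add]
      rw [card_ivl (by omega), card_ivl (by omega), card_ivl (by omega), card_ivl (by omega)]
      omega)
  refine Core.of_top (p := 2 * r + 2) (q := 2 * r + 1) (hc.congr rfl rfl ?_ rfl) rfl (by ring)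
    (by ring) (by omega) (by omega) ?_
  · ext z
    zify
    simp (disch := omega) only [Multiset.count_add, Nat.cast_add, count_ivl_step,
      count_singleton_step]
    ring_nf
  · rw [one_two_three_add_ivl (by omega)]
    simp (disch := omega) only [abs_of_neg]
    ext z
    zify
    simp (disch := omega) only [Multiset.count_add, Nat.cast_add, count_ivl_step,
      count_singleton_step, Multiset.count_zero, Nat.cast_zero]
    ring_nf

/-- The cycle takes the differences 1, …, 4r and 4r+2; the path starts at the skipped vertex r, and
its links are 4r+1 and 4r+3. -/
theorem core_four_mul_add_one {r : ℤ} (hr : 2 ≤ r) :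
    Core {1, 2, 3} {(4 * r + 1).toNat} (6 * r + 2) (r + 1) := by
  have c1 := ((alphaOdd_zero (t := r + 1) (by omega)).piece (s := 0) (r := 0) le_rfl (by omega)
    le_rfl le_rfl).anything
  have c2 := ((alphaOdd_zero (t := r) (by omega)).pieceSwap (s := r + 1) (r := r + 1) le_rfl
    (by omega) (by omega) (by omega)).anything
  have p1 := (evenPiece (x := r - 2) (t := r) (s := 2 * r + 2) (r := 2 * r + 1) (by omega)
    (by omega) (by omega) (by omega)).anything
  have hc := IsConf.addCycle (ℓ := (4 * r + 1).toNat)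
    (.path (((IsPath.single r).append p1 trivial).append (.single (-1 - 2 * r)) trivial))
    ((c1.append c2 trivial).append (.single (-2 - 2 * r)) trivial) trivial (by
      zify
      simp only [Multiset.card_add, Nat.cast_add, Multiset.card_singleton]
      rw [card_ivl (by omega), card_ivl (by omega), card_ivl (by omega), card_ivl (by omega)]
      push_cast
      omega)
  refine Core.of_bottom (p := 3 * r + 2) (q := 3 * r) (hc.congr rfl rfl ?_ rfl) rfl (by ring)
    (by ring) (by omega) (by omega) ?_
  · ext z
    zify
    simp (disch := omega) only [Multiset.count_add, Nat.cast_add, count_ivl_step,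
      count_singleton_step]
    ring_nf
  · rw [one_two_three_add_ivl (by omega)]
    simp (disch := omega) only [abs_of_pos, abs_of_neg]
    ext z
    zify
    simp (disch := omega) only [Multiset.count_add, Nat.cast_add, count_ivl_step,
      count_singleton_step, Multiset.count_zero, Nat.cast_zero]
    ring_nf

/-! ### Repeated insertion of odd cycles -/

/-- From n' ≤ 4n+2y+k+4 and y' = n+1+y one gets 7n'+6y' ≤ 34n+20y+7k+34. The room up to 49n+42y
absorbs the terms in k and, if needed, one extension; `hB` settles small cases of the latter. -/
theorem Core.add_odd_bounded {W : Multiset ℤ} {L : Multiset ℕ} {n y k K B : ℤ} (h : Core W L n y)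
    (hk : 1 ≤ k) (hkK : k ≤ K) (hn : 2 * y + 3 * K + 1 ≤ n) (hB : 49 ≤ B)
    (hb : 7 * n + 6 * y ≤ 7 * B) :
    ∃ n' y', Core W ((2 * k + 1).toNat ::ₘ L) n' y' ∧ 2 * y' + 3 * K + 1 ≤ n' ∧
      7 * n' + 6 * y' ≤ 7 * (7 * B) := by
  have hy := h.2.1
  by_cases hne : n = 4 * y + 5 * k
  -- The shortest extension leaves the exceptional size.
  · obtain ⟨n', h1, h2, h3⟩ := (h.extend (t := y + 1) (by omega)).add_odd hk (by omega) (by omega)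
    exact ⟨n', _, h3, by omega, by omega⟩
  · obtain ⟨n', h1, h2, h3⟩ := h.add_odd hk (by omega) hne
    exact ⟨n', _, h3, by omega, by omega⟩

/-- The sizes and depths of the labelings from which odd cycles are added. -/
def IsSeed (K n y : ℤ) : Prop :=
  ∃ r, 0 ≤ r ∧ y = r + 1 ∧
    (n = 4 * r + 3 ∧ 2 * r + 1 ≤ K ∨ n = 6 ∧ r = 1 ∧ 2 ≤ K ∨ n = 6 * r + 2 ∧ 2 ≤ r ∧ 2 * r ≤ K)

/-- The left side of the last inequality bounds 7n'+6y' once a cycle is added at size n+2t. -/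
theorem IsSeed.exists_extension {K n y k : ℤ} (h : IsSeed K n y) (hk : 1 ≤ k) (hkK : k ≤ K) :
    ∃ t, y < t ∧ 2 * y + 3 * K + 1 ≤ n + 2 * t ∧ n + 2 * t ≠ 4 * y + 5 * k ∧
      34 * (n + 2 * t) + 20 * y + 7 * k + 34 ≤ 7 * (7 * (4 * K + 3)) := by
  obtain ⟨r, hr, rfl, h⟩ := h
  obtain ⟨t, h1, h2, h3⟩ : ∃ t, r + 1 < t ∧ 2 * (r + 1) + 3 * K + 1 ≤ n + 2 * t ∧
      (t = r + 2 ∨ n + 2 * t ≤ 2 * (r + 1) + 3 * K + 2) :=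
    ⟨max (r + 2) ((2 * (r + 1) + 3 * K + 2 - n) / 2), by omega, by omega, by omega⟩
  by_cases hne : n + 2 * t = 4 * (r + 1) + 5 * k
  · exact ⟨t + 1, by omega, by omega, by omega, by omega⟩
  · exact ⟨t, by omega, by omega, by omega, by omega⟩

theorem Core.add_odd_of_seed {W : Multiset ℤ} {L : Multiset ℕ} {n y k K : ℤ} (h : Core W L n y)
    (hs : IsSeed K n y) (hk : 1 ≤ k) (hkK : k ≤ K) :
    ∃ n' y', Core W ((2 * k + 1).toNat ::ₘ L) n' y' ∧ 2 * y' + 3 * K + 1 ≤ n' ∧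
      7 * n' + 6 * y' ≤ 7 * (7 * (4 * K + 3)) := by
  have hy := h.2.1
  obtain ⟨t, h1, h2, h3, h4⟩ := hs.exists_extension hk hkK
  obtain ⟨n', h5, h6, h7⟩ := (h.extend h1).add_odd hk (by omega) h3
  exact ⟨n', _, h7, by omega, by omega⟩

/-- Only the seed must be enlarged to reach 2y+3K+1 ≤ n; each insertion preserves this inequality,
so the order of the cycle lengths is irrelevant. -/
theorem Core.add_odds {W : Multiset ℤ} {L : Multiset ℕ} {n y : ℤ} {K : ℕ} (h : Core W L n y)
    (hs : IsSeed K n y) (L₁ : Multiset ℕ) (hL₁ : ∀ ℓ ∈ L₁, Odd ℓ ∧ 2 < ℓ ∧ ℓ ≤ 2 * K + 1)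
    (h0 : L₁ ≠ 0) :
    ∃ n' y', Core W (L₁ + L) n' y' ∧ 2 * y' + 3 * K + 1 ≤ n' ∧
      7 * n' + 6 * y' ≤ 7 * (7 ^ L₁.card * (4 * K + 3)) := by
  induction L₁ using Multiset.induction_on with
  | empty => exact absurd rfl h0
  | cons ℓ L₁ ih =>
    obtain ⟨⟨k, hk⟩, h2, hK⟩ := hL₁ ℓ (Multiset.mem_cons_self _ _)
    have hℓ : (2 * (k : ℤ) + 1).toNat = ℓ := by omega
    by_cases hL : L₁ = 0
    · subst hL
      obtain ⟨n', y', h1, h2, h3⟩ := h.add_odd_of_seed hs (k := k) (by omega) (by omega)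
      rw [hℓ] at h1
      exact ⟨n', y', by simpa using h1, h2, by simpa using h3⟩
    · obtain ⟨n', y', h1, h2, h3⟩ := ih (fun ℓ' hℓ' => hL₁ ℓ' (Multiset.mem_cons_of_mem hℓ')) hL
      have hB : (49 : ℤ) ≤ 7 ^ L₁.card * (4 * K + 3) := by
        have : (7 : ℤ) ^ 1 ≤ 7 ^ L₁.card :=
          pow_le_pow_right₀ (by norm_num) (Multiset.card_pos.2 hL)
        nlinarith
      obtain ⟨n'', y'', h4, h5, h6⟩ :=
        h1.add_odd_bounded (k := k) (K := K) (by omega) (by omega) h2 hB h3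
      rw [hℓ] at h4
      refine ⟨n'', y'', by rwa [Multiset.cons_add], h5, ?_⟩
      rw [Multiset.card_cons, pow_succ']
      linarith

theorem exists_seed {K ℓ : ℕ} (h : Odd ℓ) (h2 : 2 < ℓ) (hK : ℓ ≤ 2 * K + 1) :
    ∃ n y, Core {1, 2, 3} {ℓ} n y ∧ IsSeed K n y := by
  obtain ⟨k, hk⟩ := h
  obtain ⟨r, hr | hr⟩ := Nat.even_or_odd' k
  · obtain rfl | hr2 : r = 1 ∨ 2 ≤ r := by omega
    · refine ⟨6, 2, ?_, 1, by omega, by omega, by omega⟩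
      convert core_five
      omega
    · refine ⟨6 * r + 2, r + 1, ?_, r, by omega, by omega, by omega⟩
      convert core_four_mul_add_one (r := r) (by omega)
      omega
  · refine ⟨4 * r + 3, r + 1, ?_, r, by omega, by omega, by omega⟩
    convert core_four_mul_add_three (r := r) (by omega)
    omega

theorem IsSeed.bound {K n y : ℤ} (h : IsSeed K n y) :
    7 * n + 6 * y ≤ 7 * (4 * K + 3) ∧ 2 * y ≤ n := by
  obtain ⟨r, hr, rfl, h⟩ := h
  omega

/-- The base multiset of absolute differences at most 3, where `a` is the number of 2-cycles. -/
def smallDiffs (a : ℕ) : Multiset ℤ := if a = 0 then {1, 2, 3} else {1, 3, 3}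

theorem exists_core (L₁ : Multiset ℕ) (a : ℕ) (hL₁ : ∀ ℓ ∈ L₁, Odd ℓ ∧ 2 < ℓ)
    (ha : a = 0 ∨ a = 1) :
    ∃ n y, Core (smallDiffs a) (L₁ + Multiset.replicate a 2) n y ∧ 2 * y ≤ n ∧
      7 * n + 6 * y ≤ 7 * (eps1 L₁ a : ℤ) + 6 := by
  obtain ⟨K, hK⟩ : ∃ K, K = (L₁.sup - 1) / 2 := ⟨_, rfl⟩
  have hM : ∀ ℓ ∈ L₁, Odd ℓ ∧ 2 < ℓ ∧ ℓ ≤ 2 * K + 1 := by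
    intro ℓ hℓ
    obtain ⟨⟨k, hk⟩, h2⟩ := hL₁ ℓ hℓ
    have := Multiset.le_sup hℓ
    exact ⟨⟨k, hk⟩, h2, by omega⟩
  have hKM : 0 < L₁.sup → 4 * K + 3 ≤ 2 * L₁.sup + 1 := by omega
  have he3 : 3 ≤ eps1 L₁ a := le_max_left _ _
  have hpow : ∀ ℓ ∈ L₁,
      7 * ((7 : ℤ) ^ (L₁.card + a - 1) * (4 * K + 3)) ≤ 7 * (eps1 L₁ a : ℤ) := by
    intro ℓ hℓ
    have h1 : 4 * K + 3 ≤ 2 * L₁.sup + 1 :=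
      hKM (by have := Multiset.le_sup hℓ; have := (hL₁ ℓ hℓ).2; omega)
    have h2 : 7 ^ (L₁.card + a - 1) * (4 * K + 3) ≤ eps1 L₁ a :=
      (Nat.mul_le_mul_left _ h1).trans (le_max_right _ _)
    exact_mod_cast Nat.mul_le_mul_left 7 h2
  rcases ha with rfl | rfl
  · simp only [Multiset.replicate_zero, add_zero]
    rcases Multiset.empty_or_exists_mem L₁ with rfl | ⟨ℓ, hℓ⟩
    · exact ⟨3, 0, core_path, by norm_num, by omega⟩
    -- One odd cycle becomes the seed, so only |L₁|-1 factors 7 arise; with a 2-cycle as seed there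
    -- are |L₁|.
    · obtain ⟨n, y, h, hs⟩ := exists_seed (hM ℓ hℓ).1 (hM ℓ hℓ).2.1 (hM ℓ hℓ).2.2
      have hp := hpow ℓ hℓ
      obtain ⟨L, rfl⟩ := Multiset.exists_cons_of_mem hℓ
      rw [Multiset.card_cons, add_zero, Nat.add_sub_cancel] at hp
      by_cases hL : L = 0
      · subst hL
        have := hs.bound
        refine ⟨n, y, h, this.2, ?_⟩
        simp only [Multiset.card_zero, pow_zero, one_mul] at hp
        omega
      · obtain ⟨n', y', h1, h2, h3⟩ :=
          h.add_odds hs L (fun ℓ' hℓ' => hM ℓ' (Multiset.mem_cons_of_mem hℓ')) hL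
        refine ⟨n', y', ?_, by omega, by omega⟩
        rwa [add_comm, Multiset.singleton_add] at h1
  · rw [Multiset.replicate_one]
    by_cases hL : L₁ = 0
    · subst hL
      exact ⟨3, 1, core_two, by norm_num, by omega⟩
    · obtain ⟨ℓ, hℓ⟩ := Multiset.exists_mem_of_ne_zero hL
      have hp := hpow ℓ hℓ
      -- The 2-cycle core has the size and depth of the triangle core, r = 0.
      have hs : IsSeed K 3 1 := ⟨0, by have := hM ℓ hℓ; omega⟩
      obtain ⟨n', y', h1, h2, h3⟩ := core_two.add_odds hs L₁ hM hL
      rw [Nat.add_sub_cancel] at hp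
      exact ⟨n', y', h1, by omega, by omega⟩

/-! ### Insertion of the even cycles and the final path -/

/-- A labeling as in `Core`, with bounds that allow to extend it to any size `N`. -/
theorem exists_extendable_core (L₀ L₁ : Multiset ℕ) (a : ℕ)
    (hL₀ : ∀ ℓ ∈ L₀, Even ℓ ∧ 2 < ℓ) (hL₁ : ∀ ℓ ∈ L₁, Odd ℓ ∧ 2 < ℓ)
    (ha : a = 0 ∨ a = 1) :
    ∃ n y, Core (smallDiffs a) (L₀ + L₁ + Multiset.replicate a 2) n y ∧
      n ≤ 4 * (eps0 L₀ : ℤ) + 5 * eps1 L₁ a + 6 ∧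
      n + 2 * y + 1 ≤ 6 * (eps0 L₀ : ℤ) + 7 * eps1 L₁ a + 9 ∧
      n + 4 * y + 1 < 6 * (eps0 L₀ : ℤ) + 7 * eps1 L₁ a + 9 := by
  obtain ⟨n, y, h, hyn, hb⟩ := exists_core L₁ a hL₁ ha
  obtain ⟨hn3, hy, -⟩ := id h
  by_cases h0 : L₀ = 0
  · have : 1 ≤ eps0 L₀ := le_max_left _ _
    refine ⟨n, y, ?_, by omega, by omega, by omega⟩
    rwa [h0, zero_add]
  have hM : ∀ ℓ ∈ L₀, Even ℓ ∧ 2 < ℓ ∧ ℓ ≤ L₀.sup :=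
    fun ℓ hℓ => ⟨(hL₀ ℓ hℓ).1, (hL₀ ℓ hℓ).2, Multiset.le_sup hℓ⟩
  have heven : Even L₀.sup := by
    clear h0 hM
    induction L₀ using Multiset.induction_on with
    | empty => simp
    | cons ℓ L ih =>
      rw [Multiset.sup_cons]
      rcases max_choice ℓ L.sup with h' | h' <;> rw [h']
      · exact (hL₀ ℓ (Multiset.mem_cons_self _ _)).1
      · exact ih fun ℓ' hℓ' => hL₀ ℓ' (Multiset.mem_cons_of_mem hℓ')
  have hMpos : 2 < L₀.sup := by
    obtain ⟨ℓ, hℓ⟩ := Multiset.exists_mem_of_ne_zero h0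
    exact (hM ℓ hℓ).2.1.trans_le (hM ℓ hℓ).2.2
  have hcard : 1 ≤ L₀.card := Multiset.card_pos.2 h0
  have he := eps0_cast L₀
  generalize hMdef : L₀.sup = M at *
  -- X is the least integer with 3M+6 ≤ 4X; each cycle then has width at most M+2.
  obtain ⟨X, hX⟩ : ∃ X : ℤ, X = (3 * (M : ℤ) + 9) / 4 := ⟨_, rfl⟩
  obtain ⟨p, hXp, hp, hS⟩ := alphaEven_cycles (X := X) (B := M + 2) (M := M) (by omega)
    (by obtain ⟨r, hr⟩ := heven; omega) L₀ hM h0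
  have hε : 2 * p + 1 ≤ (eps0 L₀ : ℤ) ∧ 2 * (M : ℤ) + 5 ≤ eps0 L₀ := by
    have h1 : (1 : ℤ) ≤ L₀.card := by exact_mod_cast hcard
    have h2 : 2 * (L₀.card : ℤ) * (M + 3) - 1 ≤ eps0 L₀ := by rw [he]; exact le_max_right _ _
    constructor <;> nlinarith
  clear hp he
  -- Merging at depth X-1 needs X-1 ≤ n'. A core that is too small is extended, to at most X unless
  -- the shortest extension already exceeds it.
  obtain ⟨n', h', hn', hcase⟩ : ∃ n', Core (smallDiffs a) (L₁ + Multiset.replicate a 2) n' y ∧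
      X - 1 ≤ n' ∧ (n' = n ∨ n < X - 1 ∧ (n' = n + 2 * (y + 1) ∨ n' ≤ X)) := by
    by_cases hnX : X - 1 ≤ n
    · exact ⟨n, h, hnX, Or.inl rfl⟩
    · exact ⟨n + 2 * max (y + 1) ((X - n) / 2), h.extend (by omega), by omega, by omega⟩
  have hm := h'.merge hS (by omega) (by omega) hn'
  rw [add_comm (L₁ + _), ← add_assoc] at hm
  exact ⟨_, _, hm, by omega, by omega, by omega⟩

/-- A path of N-n vertices at depth y surrounds the core, even or odd according to parity; N =
n+4y+1 is the odd case in which its ends would coincide. It stays separate here because its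
differences and the link are those certified to lie on the path. -/
theorem Core.exists_final {W : Multiset ℤ} {L : Multiset ℕ} {n y N : ℤ} (h : Core W L n y)
    (hN : n + 2 * y + 1 ≤ N) (hne : N ≠ n + 4 * y + 1) :
    ∃ u v v' w V V' D D', IsConf Anything L u v V D ∧ IsPath Anything v' w V' D' ∧
      V + V' = ivl 0 N ∧ D + D' + {|v - v'|} = W + ivl 4 N ∧
      D' + {|v - v'|} = ivl (n + 1) N := by
  obtain ⟨hn, hy, u, h⟩ := h
  obtain ⟨t, w, q, ht, hN', hq, hp⟩ : ∃ t w q, y < t ∧ N = n + t + q ∧ 0 ≤ q ∧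
      IsPath Anything (-1 - y) w (ivl (-t) (-1) + ivl (n + 1) (n + q))
        (ivl (n + 2) (n + t + q)) := by
    obtain ⟨t, ht | ht⟩ := Int.even_or_odd' (N - n)
    · refine ⟨t, _, t, by omega, by omega, by omega, (evenPiece (x := y) (t := t) (s := 0)
        (r := n + 1) hy (by omega) le_rfl (by omega)).anything.congr (by ring) rfl ?_ ?_⟩
      · congr 2 <;> ring
      · congr 1 <;> ring
    · refine ⟨t + 1, _, t, by omega, by omega, by omega,
        ((alphaOdd_path (x := y) (t := t + 1) hy (by omega) (by omega)).piece (s := 0)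
        (r := n + 1) hy (by omega) le_rfl (by omega)).anything.congr (by ring) rfl ?_ ?_⟩
      · congr 2 <;> ring
      · congr 1 <;> ring
  have hf : ∀ a b : ℤ, Anything a b →
      Anything (a + t) (b + t) ∧ |a + t - (b + t)| = id |a - b| :=
    fun a b _ => ⟨trivial, by rw [add_sub_add_right_eq_sub, id]⟩
  refine ⟨_, _, _, _, _, _, _, _, h.map (· + t) id hf, hp.map (· + t) id hf, ?_, ?_, ?_⟩
  · simp only [Multiset.map_add, map_ivl_add]
    ext z
    zify
    simp (disch := omega) only [Multiset.count_add, Nat.cast_add, count_ivl_step]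
    rw [hN']
    ring_nf
  · simp (disch := omega) only [Multiset.map_id, abs_of_pos]
    ext z
    zify
    simp (disch := omega) only [Multiset.count_add, Nat.cast_add, count_ivl_step,
      count_singleton_step]
    rw [hN']
    ring_nf
  · simp (disch := omega) only [Multiset.map_id, abs_of_pos]
    ext z
    zify
    simp (disch := omega) only [Multiset.count_add, Nat.cast_add, count_ivl_step,
      count_singleton_step]
    rw [hN']
    ring_nf

/-! ### From configurations to vertex sequences -/

theorem plusMinus_add (X Y : Multiset ℤ) : plusMinus (X + Y) = plusMinus X + plusMinus Y := by
  unfold plusMinus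
  rw [Multiset.map_add]
  abel

theorem le_plusMinus (X : Multiset ℤ) : X ≤ plusMinus X := Multiset.le_add_right _ _

theorem edgeDiffs_add (E F : Multiset (Sym2 ℤ)) :
    edgeDiffs (E + F) = edgeDiffs E + edgeDiffs F := Multiset.add_bind _ _ _

theorem edgeDiffs_singleton (x y : ℤ) : edgeDiffs {s(x, y)} = plusMinus {|x - y|} := by
  have h : edgeDiffs {s(x, y)} = {x - y, y - x} := by simp [edgeDiffs]
  rw [h]
  rcases abs_choice (x - y) with h | h <;> rw [h]
  · simp [plusMinus]
  · rw [Multiset.pair_comm]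
    simp [plusMinus]

theorem pathEdges_append {u v : List ℤ} {x y : ℤ} (hu : u.getLast? = some x)
    (hv : v.head? = some y) : pathEdges (u ++ v) = pathEdges u + {s(x, y)} + pathEdges v := by
  induction u with
  | nil => simp at hu
  | cons a u ih =>
    cases u with
    | nil =>
      cases v with
      | nil => simp at hv
      | cons b v =>
        simp only [List.getLast?_singleton, Option.some.injEq, List.head?_cons] at hu hv
        subst hu hv
        simp [pathEdges, ← Multiset.cons_coe]
    | cons b u =>
      have ih' := ih (by simpa using hu)
      simp only [pathEdges, List.cons_append, List.tail_cons, List.zipWith_cons_cons,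
        ← Multiset.cons_coe] at ih' ⊢
      rw [ih', Multiset.cons_add, Multiset.cons_add]

theorem zipWith_append_of_length_le {α β γ : Type*} (f : α → β → γ) (l r : List α) (m : List β)
    (h : m.length ≤ l.length) : List.zipWith f (l ++ r) m = List.zipWith f l m := by
  induction m generalizing l with
  | nil => simp
  | cons b m ih =>
    cases l with
    | nil => simp at h
    | cons a l => simpa using ih l (by simpa using h)

theorem cycleEdges_eq {u : List ℤ} {x y : ℤ} (hx : u.head? = some x) (hy : u.getLast? = some y) :
    cycleEdges u = pathEdges u + {s(y, x)} := by
  cases u with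
  | nil => simp at hx
  | cons a u =>
    simp only [List.head?_cons, Option.some.injEq] at hx
    subst hx
    -- A cycle has the edges of the walk that repeats its first vertex at the end.
    have h := pathEdges_append (v := [a]) hy rfl
    have h' : pathEdges [a] = 0 := rfl
    rw [h', add_zero] at h
    rw [← h, cycleEdges, pathEdges]
    congr 1
    rw [List.rotate_cons_succ, List.rotate_zero, List.cons_append, List.tail_cons,
      ← List.cons_append, zipWith_append_of_length_le _ _ _ _ (by simp)]

theorem IsPath.exists_list {R : ℤ → ℤ → Prop} {u v : ℤ} {V D : Multiset ℤ}
    (h : IsPath R u v V D) : ∃ P : List ℤ, P.head? = some u ∧ P.getLast? = some v ∧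
      (P : Multiset ℤ) = V ∧ edgeDiffs (pathEdges P) = plusMinus D := by
  induction h with
  | single u => exact ⟨[u], rfl, rfl, rfl, rfl⟩
  | @cons u v w V D _ _ ih =>
    obtain ⟨P, h1, h2, rfl, h4⟩ := ih
    refine ⟨[u] ++ P, rfl, ?_, rfl, ?_⟩
    · rw [List.getLast?_append, h2]; rfl
    · rw [pathEdges_append (u := [u]) (x := u) rfl h1, edgeDiffs_add, edgeDiffs_add, h4,
        edgeDiffs_singleton, ← Multiset.singleton_add, plusMinus_add]
      have : edgeDiffs (pathEdges [u]) = 0 := rfl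
      rw [this, zero_add]

theorem IsConf.exists_lists {R : ℤ → ℤ → Prop} {L : Multiset ℕ} {u v : ℤ} {V D : Multiset ℤ}
    (h : IsConf R L u v V D) : ∃ (C : Multiset (List ℤ)) (P : List ℤ), C.map List.length = L ∧
      P.getLast? = some v ∧ C.bind (fun c => (c : Multiset ℤ)) + (P : Multiset ℤ) = V ∧
      edgeDiffs (C.bind cycleEdges + pathEdges P) = plusMinus D := by
  induction h with
  | path h =>
    obtain ⟨P, -, h2, h3, h4⟩ := h.exists_list
    exact ⟨0, P, rfl, h2, by simpa using h3, by simpa using h4⟩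
  | cycle _ hp _ ih =>
    obtain ⟨C, P, rfl, h2, rfl, h4⟩ := ih
    obtain ⟨Q, h5, h6, rfl, h8⟩ := hp.exists_list
    refine ⟨Q ::ₘ C, P, by simp, h2, ?_, ?_⟩
    · rw [Multiset.cons_bind]; abel
    · rw [Multiset.cons_bind, cycleEdges_eq h5 h6, plusMinus_add, plusMinus_add, ← h4, ← h8,
        ← edgeDiffs_singleton, ← edgeDiffs_add, ← edgeDiffs_add]
      congr 1
      abel

theorem sum_map_length (C : Multiset (List ℤ)) :
    (C.bind (fun c => (c : Multiset ℤ))).card = (C.map List.length).sum := by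
  rw [Multiset.card_bind]
  rfl

theorem exists_zillionGraph {L : Multiset ℕ} {u v v' w : ℤ} {V V' D D' : Multiset ℤ} {N : ℕ}
    (h : IsConf Anything L u v V D) (h' : IsPath Anything v' w V' D') (hV : V + V' = ivl 0 N) :
    ∃ m, L.sum + m = N ∧ ∃ Γ : ZillionGraph ℤ L m, Γ.verts = Finset.Icc 0 (N : ℤ) ∧
      Γ.diffs = plusMinus (D + D' + {|v - v'|}) ∧ D' + {|v - v'|} ≤ Γ.pathDiffs := by
  obtain ⟨C, P, rfl, h2, rfl, h4⟩ := h.exists_lists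
  obtain ⟨Q, h5, h6, rfl, h8⟩ := h'.exists_list
  have hV' : C.bind (fun c => (c : Multiset ℤ)) + ((P ++ Q : List ℤ) : Multiset ℤ) = ivl 0 N := by
    rw [← hV, ← Multiset.coe_add]; abel
  have hQ : 0 < Q.length := by
    cases Q with
    | nil => simp at h5
    | cons => simp
  have hcard := congrArg Multiset.card hV'
  have hN : ((ivl 0 N).card : ℤ) = N + 1 := by rw [card_ivl (by omega)]; ring
  rw [Multiset.card_add, sum_map_length, Multiset.coe_card, List.length_append] at hcard
  have he : edgeDiffs (pathEdges (P ++ Q)) =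
      edgeDiffs (pathEdges P) + plusMinus (D' + {|v - v'|}) := by
    rw [pathEdges_append h2 h5, edgeDiffs_add, edgeDiffs_add, edgeDiffs_singleton, h8,
      plusMinus_add]
    abel
  refine ⟨P.length + Q.length - 1, by omega,
    ⟨C, P ++ Q, rfl, by rw [List.length_append]; omega, ?_⟩, ?_, ?_, ?_⟩
  · rw [hV']; exact Finset.nodup _
  · unfold ZillionGraph.verts
    simp only [hV']
    exact Finset.val_toFinset _
  · unfold ZillionGraph.diffs ZillionGraph.edges
    simp only
    rw [edgeDiffs_add, he, ← add_assoc, ← edgeDiffs_add, h4, ← plusMinus_add, add_assoc]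
  · unfold ZillionGraph.pathDiffs
    simp only
    rw [he]
    exact (le_plusMinus _).trans (Multiset.le_add_left _ _)

theorem theorem5p7 (L₀ L₁ : Multiset ℕ) (a : ℕ)
    (hL₀ : ∀ ℓ ∈ L₀, Even ℓ ∧ 2 < ℓ) (hL₁ : ∀ ℓ ∈ L₁, Odd ℓ ∧ 2 < ℓ)
    (ha : a = 0 ∨ a = 1)
    (ε : ℕ) (hε : 6 * eps0 L₀ + 7 * eps1 L₁ a + 9 ≤ ε) :
    ∃ m : ℕ, m + (L₀ + L₁).sum + 2 * a = ε ∧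
      ∃ Γ : ZillionGraph ℤ (L₀ + L₁ + Multiset.replicate a 2) m,
        Γ.IsGraceful ∧
        (Finset.Icc ((4 * eps0 L₀ + 5 * eps1 L₁ a + 7 : ℕ) : ℤ) (ε : ℤ)).val ≤ Γ.pathDiffs := by
  obtain ⟨n, y, h, h1, h2, h3⟩ := exists_extendable_core L₀ L₁ a hL₀ hL₁ ha
  obtain ⟨u, v, v', w, V, V', D, D', hc, hp, hV, hD, hD'⟩ :=
    h.exists_final (N := ε) (by omega) (by omega)
  obtain ⟨m, hm, Γ, hΓ1, hΓ2, hΓ3⟩ := exists_zillionGraph hc hp hV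
  have hcount : (L₀ + L₁ + Multiset.replicate a 2).count 2 = a := by
    rw [Multiset.count_add, Multiset.count_add, Multiset.count_replicate_self,
      Multiset.count_eq_zero_of_notMem (fun h => absurd (hL₀ 2 h).2 (by norm_num)),
      Multiset.count_eq_zero_of_notMem (fun h => absurd (hL₁ 2 h).2 (by norm_num))]
    omega
  refine ⟨m, ?_, Γ, ⟨by omega, by rw [hΓ1, hm], ?_⟩, ?_⟩
  · rw [Multiset.sum_add, Multiset.sum_replicate, smul_eq_mul] at hm
    omega
  · rw [hΓ2, hD, hcount, hm, smallDiffs]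
    split_ifs
    · rw [one_two_three_add_ivl (by omega)]; rfl
    · rfl
  · refine le_trans ?_ hΓ3
    rw [hD', ivl]
    -- The path produces n+1, …, ε, and n+1 ≤ 4ε₀+5ε₁+7.
    refine Finset.val_le_iff.2 (Finset.Icc_subset_Icc_left ?_)
    push_cast
    omega
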